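/- Let $\{0,1\}^*$ be the set of finite binary strings. A function $P:\{0,1\}^*\to[0,\infty)$ is a semimeasure if $\sum_x P(x)\le 1$. A function $f:\{0,1\}^*\to[0,\infty)$ is lower (upper) semicomputable if the set of pairs $(x,q)$, with $x$ a string and $q\ge 0$ rational, such that $q<f(x)$ (respectively $f(x)<q$) is recursively enumerable. A universal semimeasure is a lower semicomputable semimeasure $m$ such that for every lower semicomputable semimeasure $P$ there is a constant $c$ with $P(x)\le c\,m(x)$ for all $x$. A sumtest for $m$ is a function $e:\{0,1\}^*\to[0,\infty)$ with $\sum_x m(x)e(x)\le 1$. Let $K(x)$ be the prefix Kolmogorov complexity of $x$, i.e. the least length of a program for $x$ on a fixed optimal machine among the prefix machines (partial recursive functions on strings with prefix-free domain), and let $K^{0'}(x)$ be the same with respect to a fixed optimal machine among the prefix machines that have an oracle for the halting problem $0'$. (A machine $V$ of a class is optimal if for each machine $W$ of the class there is a constant $c$ such that every string with a program of length $n$ on $W$ has a program of length at most $n+c$ on $V$.) Corollary 2. Let $m$ be a universal semimeasure and let $e$ be an upper semicomputable sumtest for $m$. Then there is a constant $C$ (depending on $e$, but not on $x$) such that for all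 strings $x$ $$\log_2 e(x)\le K(x)-K^{0'}(x)+C,$$ where $\log_2 0=-\infty$. That is, up to an additive constant, $\log_2 e(x)$ is at most the mutual information $K(x)-K^{0'}(x)$ of $x$ with the halting problem. -/

import Mathlib

/-- A nonnegative real function on binary strings is lower semicomputable if its strict lower graph
over the nonnegative rationals (written `a / (b + 1)` with `a b : ℕ`) is recursively enumerable. -/
def LowerSemicomputable (f : List Bool → ℝ) : Prop :=
  REPred fun t : List Bool × ℕ × ℕ => (t.2.1 : ℝ) / ((t.2.2 : ℝ) + 1) < f t.1

/-- A nonnegative real function on binary strings is upper semicomputable if its strict upper graph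
over the nonnegative rationals (written `a / (b + 1)` with `a b : ℕ`) is recursively enumerable. -/
def UpperSemicomputable (f : List Bool → ℝ) : Prop :=
  REPred fun t : List Bool × ℕ × ℕ => f t.1 < (t.2.1 : ℝ) / ((t.2.2 : ℝ) + 1)

/-- A discrete semimeasure on binary strings. -/
def IsSemimeasure (P : List Bool → ℝ) : Prop :=
  (∀ x, 0 ≤ P x) ∧ Summable P ∧ ∑' x, P x ≤ 1

/-- A universal semimeasure: a lower semicomputable semimeasure that dominates every lower
semicomputable semimeasure up to a multiplicative constant. -/
def IsUniversalSemimeasure (m : List Bool → ℝ) : Prop :=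
  IsSemimeasure m ∧ LowerSemicomputable m ∧
    ∀ P : List Bool → ℝ, IsSemimeasure P → LowerSemicomputable P →
      ∃ c : ℝ, ∀ x, P x ≤ c * m x

/-- A sumtest for `P`. -/
def IsSumtest (P f : List Bool → ℝ) : Prop :=
  (∀ x, 0 ≤ f x) ∧ (Summable fun x => P x * f x) ∧ ∑' x, P x * f x ≤ 1

/-- A prefix machine with oracles `O`: a partial function on binary strings that is partial
recursive in `O` and whose domain is prefix-free. For `O = ∅` these are the ordinary
prefix machines. -/
def IsPrefixMachine (O : Set (ℕ →. ℕ)) (V : List Bool →. List Bool) : Prop :=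
  RecursiveIn O V ∧ ∀ p q, (V p).Dom → (V q).Dom → p <+: q → p = q

/-- A prefix machine with oracles `O` that is optimal among all such machines: it produces every
output of any other one by programs longer by at most an additive constant. -/
def IsOptimalPrefixMachine (O : Set (ℕ →. ℕ)) (V : List Bool →. List Bool) : Prop :=
  IsPrefixMachine O V ∧
    ∀ W : List Bool →. List Bool, IsPrefixMachine O W →
      ∃ c : ℕ, ∀ p x, x ∈ W p → ∃ q, x ∈ V q ∧ q.length ≤ p.length + c

/-- The complexity of `x` on the machine `V`: the least length of a program that outputs `x`.
(On an optimal machine every string has a program.) -/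
noncomputable def complexity (V : List Bool →. List Bool) (x : List Bool) : ℕ :=
  sInf {n | ∃ p, x ∈ V p ∧ p.length = n}

/-- The halting problem, as the total characteristic function of the set of (coded) pairs
(program, input) such that the program halts on the input. -/
noncomputable def haltingProblem : ℕ →. ℕ := fun n =>
  open Classical in
  Part.some
    (if ((Denumerable.ofNat Nat.Partrec.Code n.unpair.1).eval n.unpair.2).Dom then 1 else 0)

/-! The weights `m x * e x` have total at most 1, so a code in which `x` has length about `-log (m x
* e x)` satisfies Kraft's inequality. Neither semicomputability assumption makes these lengths
computable, but both make them computable in the limit: the least `a` with `2⁻¹ ^ a < m x` and the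
least `b` with `e x < 2 ^ b` are least witnesses of enumerable relations. A decoder with the halting
problem can recognise when a limit has settled, so the Shannon–Fano code with these lengths is
decoded by an oracle prefix machine (`exists_prefixMachine_haltingProblem`). Hence `m * e` is at
most a constant times two to the minus oracle complexity (`exists_mul_sumtest_le`). On the other
side, two to the minus plain complexity is a lower semicomputable semimeasure, so `m` dominates it
(`IsUniversalSemimeasure.exists_le_of_machine`). Multiplying by `e` and taking logarithms gives the
bound. -/

/-! ### Enumerable relations, limits and search with a halting oracle -/

section Computability

variable {α σ : Type*} [Primcodable α] [Primcodable σ]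

open Encodable Nat.Partrec Filter

/-- The graph of a partial recursive function is the union of an increasing computable sequence of
primitive recursive relations. -/
theorem Partrec.exists_stage {f : α →. σ} (hf : Partrec f) :
    ∃ r : (α × σ) → ℕ → Bool, Primrec₂ r ∧ (∀ a y, y ∈ f a ↔ ∃ s, r (a, y) s) ∧
      ∀ z s t, s ≤ t → r z s → r z t := by
  classical
  obtain ⟨c, hc⟩ := Code.exists_code.1 hf
  refine ⟨fun z s => decide (Code.evaln s c (encode z.1) = some (encode z.2)), ?_, ?_, ?_⟩
  · exact (Primrec.eq.comp (Code.primrec_evaln.comp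
      ((Primrec.snd.pair (Primrec.const c)).pair
        (Primrec.encode.comp (Primrec.fst.comp Primrec.fst))))
      (Primrec.option_some.comp (Primrec.encode.comp (Primrec.snd.comp Primrec.fst)))).decide
  · intro a y
    have h := @Code.evaln_complete c (encode a) (encode y)
    simpa [hc] using h
  · intro z s t hst h
    simp only [decide_eq_true_eq] at h ⊢
    exact Code.evaln_mono hst h

/-- A recursively enumerable predicate is the union of an increasing computable sequence of
primitive recursive predicates. -/
theorem REPred.exists_stage {P : α → Prop} (hP : REPred P) :
    ∃ r : α → ℕ → Bool, Primrec₂ r ∧ (∀ a, P a ↔ ∃ s, r a s) ∧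
      ∀ a s t, s ≤ t → r a s → r a t := by
  obtain ⟨r, hr, hP', hmono⟩ := Partrec.exists_stage hP
  refine ⟨fun a s => r (a, ()) s,
    hr.comp₂ (Primrec.fst.pair (Primrec.const ())).to₂ Primrec₂.right, fun a => ?_,
    fun a => hmono (a, ())⟩
  simpa using hP' a ()

/-- Projections of computable relations are recursively enumerable. -/
theorem REPred.exists_nat {r : α → ℕ → Bool} (hr : Computable₂ r) :
    REPred fun a => ∃ s, r a s := by
  have h : Partrec fun a => Nat.rfind fun n => Part.some (r a n) := Partrec.rfind hr.partrec₂
  refine h.dom_re.of_eq fun a => ?_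
  refine Nat.rfind_dom.trans ?_
  simp

theorem REPred.comp {P : σ → Prop} (hP : REPred P) {f : α → σ} (hf : Computable f) :
    REPred fun a => P (f a) :=
  Partrec.comp hP hf

/-- The least witness of a recursively enumerable relation is computable in the limit. -/
theorem REPred.exists_limit_find {P : α × ℕ → Prop} (hP : REPred P)
    (hex : ∀ a, ∃ n, P (a, n)) :
    ∃ A : α × ℕ → ℕ, Computable A ∧ ∀ a, ∃ n, P (a, n) ∧ (∀ k < n, ¬ P (a, k)) ∧
      ∀ᶠ s in atTop, A (a, s) = n := by
  classical
  obtain ⟨r, hr, hPr, hmono⟩ := hP.exists_stage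
  -- Cutting the search off at the stage number makes it total; the cutoff is harmless once the
  -- stage exceeds the true least witness.
  have hex' : ∀ z : α × ℕ, ∃ n, z.2 ≤ n ∨ r (z.1, n) z.2 := fun z => ⟨z.2, Or.inl le_rfl⟩
  refine ⟨fun z => Nat.find (hex' z), ?_, fun a => ⟨Nat.find (hex a), Nat.find_spec (hex a),
    fun k hk => Nat.find_min (hex a) hk, ?_⟩⟩
  · refine Computable.find (P := fun (z : α × ℕ) n => z.2 ≤ n ∨ r (z.1, n) z.2) ?_ hex'
    refine PrimrecPred.computablePred (PrimrecPred.or ?_ ?_)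
    · exact Primrec.nat_le.comp (Primrec.snd.comp Primrec.fst) Primrec.snd
    · exact Primrec.eq.comp (hr.comp ((Primrec.fst.comp Primrec.fst).pair Primrec.snd)
        (Primrec.snd.comp Primrec.fst)) (Primrec.const true)
  · obtain ⟨s₀, hs₀⟩ := (hPr _).1 (Nat.find_spec (hex a))
    filter_upwards [eventually_ge_atTop s₀, eventually_gt_atTop (Nat.find (hex a))] with s h1 h2
    rw [Nat.find_eq_iff]
    refine ⟨Or.inr (hmono _ _ _ h1 hs₀), fun k hk h => ?_⟩
    rcases h with h | h
    · omega
    · exact Nat.find_min (hex a) hk ((hPr _).2 ⟨s, h⟩)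

open Classical in
/-- Unbounded search for a witness of a co-enumerable relation is recursive in the halting
problem. -/
theorem recursiveIn_haltingProblem_rfind {R : α × ℕ → Prop} (hR : REPred fun z => ¬ R z)
    {out : ℕ → σ} (hout : Computable out) :
    RecursiveIn {haltingProblem} fun a =>
      (Nat.rfind fun n => Part.some (decide (R (a, n)))).map out := by
  obtain ⟨c, hc⟩ := Code.exists_code.1 hR
  -- `c` halts exactly where `R` fails, so the oracle answers 0 exactly where `R` holds, and `rfind`
  -- looks for a zero.
  have hq : Nat.RecursiveIn {haltingProblem} fun m => haltingProblem (Nat.pair (encode c) m) := by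
    have h1 : Nat.Partrec fun m => Part.some (Nat.pair (encode c) m) :=
      Partrec.nat_iff.1 (Primrec₂.natPair.comp (Primrec.const (encode c)) Primrec.id).to_comp
    refine (Nat.RecursiveIn.comp (.oracle haltingProblem (Set.mem_singleton _))
      h1.recursiveIn).of_eq fun m => ?_
    exact Part.bind_some _ _
  have hin : Nat.Partrec fun n => ((decode n : Option α) : Part α).map encode :=
    Partrec.nat_iff.1 (Computable.decode.ofOption.map (Computable.encode.comp Computable.snd).to₂)
  have hout' : Nat.Partrec fun n => Part.some (encode (out n)) :=
    Partrec.nat_iff.1 (Computable.encode.comp hout)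
  refine (Nat.RecursiveIn.comp hout'.recursiveIn
    (Nat.RecursiveIn.comp (Nat.RecursiveIn.rfind hq) hin.recursiveIn)).of_eq fun n => ?_
  rcases hd : (decode n : Option α) with _ | a
  · simp
  · have key : ∀ k, haltingProblem (Nat.pair (encode c) (Nat.pair (encode a) k)) =
        Part.some (if R (a, k) then 0 else 1) := by
      intro k
      have : Nat.pair (encode a) k = encode (a, k) := by simp
      rw [haltingProblem, this]
      simp only [Nat.unpair_pair, Denumerable.ofNat_encode, hc]
      by_cases h : R (a, k) <;> simp [h, Part.assert]
    have hfun : (fun k => (fun m : ℕ => decide (m = 0)) <$>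
        haltingProblem (Nat.pair (encode c) (Nat.pair (encode a) k))) =
        fun k => Part.some (decide (R (a, k))) := by
      funext k
      rw [key]
      by_cases h : R (a, k) <;> simp [h]
    simp only [Part.coe_some, Part.map_some, Part.bind_eq_bind, Part.bind_some, Part.map_map]
    rw [hfun, Part.bind_some_eq_map]
    rfl

/-- The inverse of a computable bijection onto the natural numbers is computable. -/
theorem Computable.equiv_symm {E : α ≃ ℕ} (hE : Computable E) : Computable E.symm := by
  classical
  have hex : ∀ i, ∃ n, (decode n : Option α).map E = some i := fun i =>
    ⟨encode (E.symm i), by simp⟩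
  have hfind : Computable fun i => Nat.find (hex i) := by
    refine Computable.find (P := fun i n => (decode n : Option α).map E = some i) ?_ hex
    exact Computable.computablePred (Primrec.eq.decide.to_comp.comp
      (Computable.option_map (Computable.decode.comp Computable.snd) (hE.comp Computable.snd).to₂)
      (Computable.option_some.comp Computable.fst))
  refine Computable.option_some_iff.1 ((Computable.decode.comp hfind).of_eq fun i => ?_)
  obtain ⟨a, ha, hi⟩ := Option.map_eq_some_iff.1 (Nat.find_spec (hex i))
  rw [ha, ← hi, E.symm_apply_apply]

/-- The number of a binary string in the length-lexicographic order of reversed strings. -/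
def stringIndex (x : List Bool) : ℕ :=
  x.foldr (fun b i => 2 * i + 1 + b.toNat) 0

/-- This is bijective base 2, with digits 1 and 2 and the least significant first: parity determines
the head, and halving gives the tail. -/
theorem stringIndex_bijective : Function.Bijective stringIndex := by
  constructor
  · intro x
    induction x with
    | nil =>
      intro y h
      cases y with
      | nil => rfl
      | cons c y => simp [stringIndex] at h; omega
    | cons b x ih =>
      intro y h
      cases y with
      | nil => simp [stringIndex] at h
      | cons c y =>
        simp only [stringIndex, List.foldr_cons] at h
        have hbc : b = c := by cases b <;> cases c <;> simp at h ⊢ <;> omega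
        subst hbc
        rw [ih (show stringIndex x = stringIndex y by simp only [stringIndex]; omega)]
  · intro i
    induction i using Nat.strong_induction_on with
    | _ i ih =>
      rcases Nat.eq_zero_or_pos i with rfl | hi
      · exact ⟨[], rfl⟩
      · obtain ⟨x, hx⟩ := ih ((i - 1) / 2) (by omega)
        refine ⟨decide ((i - 1) % 2 = 1) :: x, ?_⟩
        simp only [stringIndex, List.foldr_cons] at hx ⊢
        rcases Nat.mod_two_eq_zero_or_one (i - 1) with h2 | h2 <;> simp [h2, hx] <;> omega

theorem primrec_stringIndex : Primrec stringIndex := by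
  refine Primrec.list_foldr Primrec.id (Primrec.const 0)
    (h := fun _ (z : Bool × ℕ) => 2 * z.2 + 1 + z.1.toNat) ?_
  refine Primrec.nat_add.comp (Primrec.succ.comp (Primrec.nat_mul.comp (Primrec.const 2)
    (Primrec.snd.comp Primrec.snd))) ?_
  exact (Primrec.dom_finite Bool.toNat).comp (Primrec.fst.comp Primrec.snd)

/-- A computable enumeration of all binary strings without repetitions. -/
theorem exists_computable_equiv_string : ∃ E : ℕ ≃ List Bool, Computable E :=
  ⟨(Equiv.ofBijective _ stringIndex_bijective).symm,
    Computable.equiv_symm (E := Equiv.ofBijective _ stringIndex_bijective)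
      primrec_stringIndex.to_comp⟩

end Computability

/-! ### Dyadic intervals and Shannon–Fano codes -/

section BinaryCodes

open Filter

/-- The number with binary expansion `p`, most significant digit first. -/
def binaryValue (p : List Bool) : ℕ :=
  p.foldl (fun v b => 2 * v + b.toNat) 0

theorem foldl_binaryValue (p : List Bool) (v : ℕ) :
    p.foldl (fun v b => 2 * v + b.toNat) v = v * 2 ^ p.length + binaryValue p := by
  unfold binaryValue
  induction p generalizing v with
  | nil => simp
  | cons b p ih =>
    simp only [List.foldl_cons, List.length_cons]
    rw [ih, ih (2 * 0 + b.toNat)]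
    ring

theorem binaryValue_append (p q : List Bool) :
    binaryValue (p ++ q) = binaryValue p * 2 ^ q.length + binaryValue q := by
  rw [binaryValue, List.foldl_append, foldl_binaryValue]
  rfl

theorem binaryValue_lt (p : List Bool) : binaryValue p < 2 ^ p.length := by
  induction p using List.reverseRecOn with
  | nil => simp [binaryValue]
  | append_singleton p b ih =>
    rw [binaryValue_append]
    have hb : binaryValue [b] < 2 := by cases b <;> simp [binaryValue]
    simp only [List.length_append, List.length_singleton, pow_succ, pow_zero]
    omega

theorem exists_binaryValue_eq (n t : ℕ) (h : t < 2 ^ n) :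
    ∃ p : List Bool, p.length = n ∧ binaryValue p = t := by
  induction n generalizing t with
  | zero => exact ⟨[], rfl, by simp at h; simp [binaryValue, h]⟩
  | succ n ih =>
    obtain ⟨p, hp, hv⟩ := ih (t / 2) (by rw [pow_succ] at h; omega)
    refine ⟨p ++ [decide (t % 2 = 1)], by simp [hp], ?_⟩
    rw [binaryValue_append, hv]
    rcases Nat.mod_two_eq_zero_or_one t with h2 | h2 <;> simp [binaryValue, h2] <;> omega

theorem primrec_binaryValue : Primrec binaryValue := by
  refine Primrec.list_foldl Primrec.id (Primrec.const 0)
    (h := fun _ (z : ℕ × Bool) => 2 * z.1 + z.2.toNat) ?_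
  refine Primrec.nat_add.comp (Primrec.nat_mul.comp (Primrec.const 2)
    (Primrec.fst.comp Primrec.snd)) ?_
  exact (Primrec.dom_finite Bool.toNat).comp (Primrec.snd.comp Primrec.snd)

/-- The left end of the dyadic interval of an extension of `p` lies in the interval of `p`. -/
theorem binaryValue_div_mem_of_prefix {p q : List Bool} (h : p <+: q) :
    (binaryValue q : ℝ) / 2 ^ q.length ∈
      Set.Ico ((binaryValue p : ℝ) / 2 ^ p.length) ((binaryValue p + 1 : ℝ) / 2 ^ p.length) := by
  obtain ⟨r, rfl⟩ := h
  have h1 : (binaryValue r : ℝ) < 2 ^ r.length := by exact_mod_cast binaryValue_lt r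
  rw [binaryValue_append, List.length_append, pow_add]
  push_cast
  have h2 : (0 : ℝ) < 2 ^ p.length := by positivity
  have h3 : (0 : ℝ) < 2 ^ r.length := by positivity
  have h4 : ((binaryValue p : ℝ) * 2 ^ r.length + binaryValue r) / (2 ^ p.length * 2 ^ r.length) =
      (binaryValue p + binaryValue r / 2 ^ r.length) / 2 ^ p.length := by
    field_simp
  have h5 : (binaryValue r : ℝ) / 2 ^ r.length < 1 := (div_lt_one h3).2 h1
  rw [h4]
  refine ⟨by gcongr; exact le_add_of_nonneg_right (by positivity), by gcongr⟩

/-- Numerator and binary exponent of the denominator of `∑ j < x, 2 ^ (-n j)`. -/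
def dyadicSum (n : ℕ → ℕ) (x : ℕ) : ℕ × ℕ :=
  Nat.rec (0, 0) (fun j q => (q.1 * 2 ^ n j + 2 ^ q.2, q.2 + n j)) x

theorem dyadicSum_eq (n : ℕ → ℕ) (x : ℕ) :
    ((dyadicSum n x).1 : ℝ) / 2 ^ (dyadicSum n x).2 = ∑ j ∈ Finset.range x, (2⁻¹ : ℝ) ^ n j := by
  induction x with
  | zero => simp [dyadicSum]
  | succ x ih =>
    rw [Finset.sum_range_succ, ← ih]
    have : dyadicSum n (x + 1) = ((dyadicSum n x).1 * 2 ^ n x + 2 ^ (dyadicSum n x).2,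
      (dyadicSum n x).2 + n x) := rfl
    rw [this]
    push_cast
    rw [pow_add, inv_pow]
    field_simp

theorem dyadicSum_congr {n n' : ℕ → ℕ} {x : ℕ} (h : ∀ j < x, n j = n' j) :
    dyadicSum n x = dyadicSum n' x := by
  induction x with
  | zero => rfl
  | succ x ih =>
    have := ih fun j hj => h j (by omega)
    simp only [dyadicSum] at this ⊢
    rw [this, h x (by omega)]

/-- The code word of `x` in the Shannon–Fano code with lengths `n x + 1`, as a pair of its binary
value and its length. -/
def shannonFano (n : ℕ → ℕ) (x : ℕ) : ℕ × ℕ :=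
  ((dyadicSum n x).1 * 2 ^ (n x + 1) / 2 ^ (dyadicSum n x).2 + 1, n x + 1)

theorem shannonFano_congr {n n' : ℕ → ℕ} {x : ℕ} (h : ∀ j ≤ x, n j = n' j) :
    shannonFano n x = shannonFano n' x := by
  rw [shannonFano, shannonFano, dyadicSum_congr fun j hj => h j hj.le, h x le_rfl]

/-- Rounding down and adding 1 passes strictly beyond the partial sum. With the next lemma, this
puts the dyadic interval of the code word inside the slot of width `2⁻¹ ^ n x` reserved for `x`; the
extra bit makes that slot two dyadic steps wide, which leaves room for the rounding. -/
theorem sum_lt_shannonFano (n : ℕ → ℕ) (x : ℕ) :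
    ∑ j ∈ Finset.range x, (2⁻¹ : ℝ) ^ n j < (shannonFano n x).1 / 2 ^ (shannonFano n x).2 := by
  rw [← dyadicSum_eq, shannonFano, div_lt_div_iff₀ (by positivity) (by positivity),
    mul_comm _ (2 ^ _)]
  norm_cast
  rw [mul_comm (2 ^ _)]
  exact (Nat.lt_mul_div_succ _ (by positivity)).trans_eq (mul_comm _ _)

theorem shannonFano_le_sum (n : ℕ → ℕ) (x : ℕ) :
    ((shannonFano n x).1 + 1 : ℝ) / 2 ^ (shannonFano n x).2 ≤
      ∑ j ∈ Finset.range (x + 1), (2⁻¹ : ℝ) ^ n j := by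
  rw [Finset.sum_range_succ, ← dyadicSum_eq, shannonFano]
  have h : (((dyadicSum n x).1 * 2 ^ (n x + 1) / 2 ^ (dyadicSum n x).2 : ℕ) : ℝ) ≤
      (dyadicSum n x).1 * 2 ^ (n x + 1) / 2 ^ (dyadicSum n x).2 := by
    refine Nat.cast_div_le.trans_eq ?_
    push_cast
    rfl
  rw [div_le_iff₀ (by positivity)]
  push_cast
  have h2 : (((dyadicSum n x).1 : ℝ) / 2 ^ (dyadicSum n x).2 + 2⁻¹ ^ n x) * 2 ^ (n x + 1) =
      (dyadicSum n x).1 * 2 ^ (n x + 1) / 2 ^ (dyadicSum n x).2 + 2 := by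
    rw [inv_pow, pow_succ]
    field_simp
  rw [h2]
  linarith

/-- A prefix relation puts the left end of one interval inside the other, while distinct indices
have disjoint slots. -/
theorem eq_of_shannonFano_prefix {n : ℕ → ℕ} {x y : ℕ} {p q : List Bool}
    (hp : shannonFano n x = (binaryValue p, p.length))
    (hq : shannonFano n y = (binaryValue q, q.length)) (hpq : p <+: q) : x = y := by
  have hx := sum_lt_shannonFano n x
  have hx' := shannonFano_le_sum n x
  have hy := sum_lt_shannonFano n y
  have hy' := shannonFano_le_sum n y
  obtain ⟨h1, h2⟩ := binaryValue_div_mem_of_prefix hpq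
  have hmono : ∀ i j, i < j → ∑ k ∈ Finset.range (i + 1), (2⁻¹ : ℝ) ^ n k ≤
      ∑ k ∈ Finset.range j, (2⁻¹ : ℝ) ^ n k := fun i j hij =>
    Finset.sum_le_sum_of_subset_of_nonneg (Finset.range_mono hij) fun _ _ _ => by positivity
  rw [hp] at hx hx'
  rw [hq] at hy hy'
  rcases lt_trichotomy x y with h | rfl | h
  · have := hmono x y h
    simp only at *
    linarith
  · rfl
  · have := hmono y x h
    have h3 : (binaryValue q : ℝ) / 2 ^ q.length < (binaryValue q + 1) / 2 ^ q.length := by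
      gcongr
      linarith
    simp only at *
    linarith

theorem primrec_nat_pow : Primrec₂ ((· ^ ·) : ℕ → ℕ → ℕ) :=
  Primrec₂.unpaired'.1 Nat.Primrec.pow

theorem computable_shannonFano {ν : ℕ × ℕ → ℕ} (hν : Computable ν) :
    Computable fun z : ℕ × ℕ => shannonFano (fun j => ν (j, z.2)) z.1 := by
  have hpow : ∀ {g : (ℕ × ℕ) × ℕ × ℕ × ℕ → ℕ}, Computable g → Computable fun z => 2 ^ g z :=
    fun hg => primrec_nat_pow.to_comp.comp (Computable.const 2) hg
  have hpow' : ∀ {g : ℕ × ℕ → ℕ}, Computable g → Computable fun z => 2 ^ g z :=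
    fun hg => primrec_nat_pow.to_comp.comp (Computable.const 2) hg
  have hsum : Computable fun z : ℕ × ℕ => dyadicSum (fun j => ν (j, z.2)) z.1 := by
    refine Computable.nat_rec (f := Prod.fst) (g := fun _ => ((0, 0) : ℕ × ℕ))
      (h := fun z w => (w.2.1 * 2 ^ ν (w.1, z.2) + 2 ^ w.2.2, w.2.2 + ν (w.1, z.2)))
      Computable.fst (Computable.const _) ?_
    have hw : Computable fun u : (ℕ × ℕ) × ℕ × ℕ × ℕ => u.2.2 := Computable.snd.comp Computable.snd
    have hν' : Computable fun u : (ℕ × ℕ) × ℕ × ℕ × ℕ => ν (u.2.1, u.1.2) :=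
      hν.comp ((Computable.fst.comp Computable.snd).pair (Computable.snd.comp Computable.fst))
    exact (Primrec.nat_add.to_comp.comp
      (Primrec.nat_mul.to_comp.comp (Computable.fst.comp hw) (hpow hν'))
      (hpow (Computable.snd.comp hw))).pair
      (Primrec.nat_add.to_comp.comp (Computable.snd.comp hw) hν')
  have hlen : Computable fun z : ℕ × ℕ => ν (z.1, z.2) + 1 := Computable.succ.comp hν
  exact (Computable.succ.comp (Primrec.nat_div.to_comp.comp
    (Primrec.nat_mul.to_comp.comp (Computable.fst.comp hsum) (hpow' hlen))
    (hpow' (Computable.snd.comp hsum)))).pair hlen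

/-- The Kraft–Chaitin theorem relative to the halting problem, for lengths that are computable in
the limit. -/
theorem exists_prefixMachine_haltingProblem {out : ℕ → List Bool} (hout : Computable out)
    {ν : ℕ × ℕ → ℕ} (hν : Computable ν) {n : ℕ → ℕ}
    (hlim : ∀ x, ∀ᶠ s in atTop, ν (x, s) = n x)
    (hsum : ∀ x, ∑ j ∈ Finset.range x, (2⁻¹ : ℝ) ^ n j ≤ 1) :
    ∃ W, IsPrefixMachine {haltingProblem} W ∧
      ∀ x, ∃ p, out x ∈ W p ∧ p.length = n x + 1 := by
  classical
  let γ : ℕ × ℕ → ℕ × ℕ := fun z => shannonFano (fun j => ν (j, z.2)) z.1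
  have hγ : Computable γ := computable_shannonFano hν
  have hγlim : ∀ x, ∀ᶠ s in atTop, γ (x, s) = shannonFano n x := by
    intro x
    have : ∀ᶠ s in atTop, ∀ j ∈ Set.Iic x, ν (j, s) = n j :=
      (eventually_all_finite (Set.finite_Iic x)).2 fun j _ => hlim j
    filter_upwards [this] with s hs
    exact shannonFano_congr hs
  -- The second component codes an index and a stage from which its approximate code word stays
  -- equal to the given string. A single universal quantifier makes this co-enumerable.
  let R : List Bool × ℕ → Prop := fun z =>
    ∀ s, γ (z.2.unpair.1, z.2.unpair.2 + s) = (binaryValue z.1, z.1.length)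
  have hR : REPred fun z => ¬ R z := by
    refine (REPred.exists_nat (r := fun z s =>
      !decide (γ (z.2.unpair.1, z.2.unpair.2 + s) = (binaryValue z.1, z.1.length))) ?_).of_eq
      fun z => by simp [R]
    have hu : Computable fun u : (List Bool × ℕ) × ℕ => u.1.2.unpair :=
      Computable.unpair.comp (Computable.snd.comp Computable.fst)
    exact Primrec.not.to_comp.comp (Primrec.eq.decide.to_comp.comp
      (hγ.comp ((Computable.fst.comp hu).pair
        (Primrec.nat_add.to_comp.comp (Computable.snd.comp hu) Computable.snd)))
      ((primrec_binaryValue.to_comp.comp (Computable.fst.comp Computable.fst)).pair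
        (Computable.list_length.comp (Computable.fst.comp Computable.fst))))
  have hRlim : ∀ p k, R (p, k) → shannonFano n k.unpair.1 = (binaryValue p, p.length) := by
    intro p k h
    obtain ⟨s, hs⟩ := eventually_atTop.1 (hγlim k.unpair.1)
    rw [← hs (k.unpair.2 + s) (by omega)]
    exact h s
  let W : List Bool →. List Bool := fun p =>
    (Nat.rfind fun k => Part.some (decide (R (p, k)))).map fun k => out k.unpair.1
  have hdom : ∀ p, (W p).Dom → ∃ k, R (p, k) := by
    intro p h
    obtain ⟨y, hy⟩ := Part.dom_iff_mem.1 h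
    obtain ⟨k, hk, -⟩ := (Part.mem_map_iff _).1 hy
    exact ⟨k, by simpa using Nat.rfind_spec hk⟩
  refine ⟨W, ⟨recursiveIn_haltingProblem_rfind hR
    (hout.comp (Computable.fst.comp Computable.unpair)), fun p q hp hq hpq => ?_⟩, fun x => ?_⟩
  · obtain ⟨k, hk⟩ := hdom p hp
    obtain ⟨l, hl⟩ := hdom q hq
    have h := hRlim q l hl
    rw [← eq_of_shannonFano_prefix (hRlim p k hk) h hpq, hRlim p k hk, Prod.mk.injEq] at h
    exact hpq.eq_of_length h.2
  · have hlt : (shannonFano n x).1 < 2 ^ (shannonFano n x).2 := by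
      have h := (shannonFano_le_sum n x).trans (hsum (x + 1))
      rw [div_le_one (by positivity)] at h
      exact_mod_cast h
    obtain ⟨p, hp, hv⟩ := exists_binaryValue_eq _ _ hlt
    refine ⟨p, ?_, hp⟩
    obtain ⟨s₀, hs₀⟩ := eventually_atTop.1 (hγlim x)
    have hRx : R (p, Nat.pair x s₀) := by
      intro s
      simp only [Nat.unpair_pair]
      rw [hs₀ _ (by omega), hp, hv]
    -- The search may stop at another pair, but no two indices share a code word, so the output is
    -- the same.
    obtain ⟨k, hk, -⟩ := Nat.rfind_min' (p := fun k => decide (R (p, k)))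
      (m := Nat.pair x s₀) (by simpa using hRx)
    have hRk : R (p, k) := by simpa using Nat.rfind_spec hk
    refine (Part.mem_map_iff _).2 ⟨k, hk, ?_⟩
    have hx : shannonFano n x = (binaryValue p, p.length) := by rw [hv, hp]
    rw [eq_of_shannonFano_prefix hx (hRlim p k hRk) (List.prefix_refl p)]

end BinaryCodes

/-! ### Kraft's inequality and the semimeasure given by complexity -/

section Complexity

open InformationTheory

theorem uniquelyDecodable_of_prefix_free {α : Type*} {S : Set (List α)} (hnil : [] ∉ S)
    (hS : ∀ p ∈ S, ∀ q ∈ S, p <+: q → p = q) : UniquelyDecodable S := by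
  intro L₁
  induction L₁ with
  | nil =>
    intro L₂ _ h₂ h
    cases L₂ with
    | nil => rfl
    | cons q L₂ =>
      simp only [List.flatten_nil, List.flatten_cons, List.nil_eq, List.append_eq_nil_iff] at h
      exact absurd (h.1 ▸ h₂ q (by simp)) hnil
  | cons p L₁ ih =>
    intro L₂ h₁ h₂ h
    cases L₂ with
    | nil =>
      simp only [List.flatten_nil, List.flatten_cons, List.append_eq_nil_iff] at h
      exact absurd (h.1 ▸ h₁ p (by simp)) hnil
    | cons q L₂ =>
      simp only [List.flatten_cons] at h
      have hp := h₁ p (by simp)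
      have hq := h₂ q (by simp)
      have hpq : p = q := by
        rcases List.prefix_or_prefix_of_prefix (List.prefix_append p L₁.flatten)
          (h ▸ List.prefix_append q L₂.flatten) with h' | h'
        · exact hS p hp q hq h'
        · exact (hS q hq p hp h').symm
      subst hpq
      rw [ih L₂ (fun w hw => h₁ w (by simp [hw])) (fun w hw => h₂ w (by simp [hw]))
        (List.append_cancel_left h)]

/-- The Kraft inequality for finite prefix-free sets of binary strings. -/
theorem kraft_inequality_of_prefix_free {S : Finset (List Bool)}
    (hS : ∀ p ∈ S, ∀ q ∈ S, p <+: q → p = q) : ∑ p ∈ S, (2⁻¹ : ℝ) ^ p.length ≤ 1 := by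
  by_cases hnil : [] ∈ S
  · have : S = {[]} := by
      ext q
      rw [Finset.mem_singleton]
      exact ⟨fun hq => (hS [] hnil q hq List.nil_prefix).symm, fun hq => hq ▸ hnil⟩
    simp [this]
  · simpa using kraft_mcmillan_inequality
      (uniquelyDecodable_of_prefix_free (S := (S : Set (List Bool))) hnil hS)

variable {O : Set (ℕ →. ℕ)} {V : List Bool →. List Bool}

theorem IsOptimalPrefixMachine.exists_program (hV : IsOptimalPrefixMachine O V) (x : List Bool) :
    ∃ p, x ∈ V p := by
  let W : List Bool →. List Bool := fun p => bif decide (p = []) then Part.some x else Part.none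
  have hW : Partrec W := Partrec.cond
    (Primrec.eq.decide.to_comp.comp Computable.id (Computable.const []))
    (Computable.const x).partrec Partrec.none
  have hdom : ∀ p, (W p).Dom → p = [] := by
    intro p h
    by_contra hp
    simp [W, hp] at h
  obtain ⟨c, hc⟩ := hV.2 W ⟨hW.recursiveIn, fun p q hp hq _ => by rw [hdom p hp, hdom q hq]⟩
  obtain ⟨q, hq, -⟩ := hc [] x (by simp [W])
  exact ⟨q, hq⟩

theorem complexity_le {p x : List Bool} (h : x ∈ V p) : complexity V x ≤ p.length :=
  Nat.sInf_le ⟨p, h, rfl⟩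

theorem exists_program_length_eq_complexity {x : List Bool} (h : ∃ p, x ∈ V p) :
    ∃ p, x ∈ V p ∧ p.length = complexity V x :=
  Nat.sInf_mem (s := {n | ∃ p, x ∈ V p ∧ p.length = n}) (h.elim fun p hp => ⟨_, p, hp, rfl⟩)

/-- Shortest programs of distinct strings are distinct elements of a prefix-free domain, so Kraft's
inequality bounds every finite sum. -/
theorem IsOptimalPrefixMachine.isSemimeasure (hV : IsOptimalPrefixMachine O V) :
    IsSemimeasure fun x => (2⁻¹ : ℝ) ^ complexity V x := by
  classical
  choose P hP hlen using fun x => exists_program_length_eq_complexity (hV.exists_program x)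
  have hinj : Function.Injective P := fun x y h => Part.mem_unique (hP x) (h ▸ hP y)
  have hle : ∀ s : Finset (List Bool), ∑ x ∈ s, (2⁻¹ : ℝ) ^ complexity V x ≤ 1 := by
    intro s
    have := kraft_inequality_of_prefix_free (S := s.image P) (by
      intro p hp q hq hpq
      obtain ⟨x, -, rfl⟩ := Finset.mem_image.1 hp
      obtain ⟨y, -, rfl⟩ := Finset.mem_image.1 hq
      exact hV.1.2 _ _ (Part.dom_iff_mem.2 ⟨x, hP x⟩) (Part.dom_iff_mem.2 ⟨y, hP y⟩) hpq)
    rw [Finset.sum_image hinj.injOn] at this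
    simpa only [hlen] using this
  have hsum : Summable fun x => (2⁻¹ : ℝ) ^ complexity V x :=
    summable_of_sum_le (fun _ => by positivity) hle
  exact ⟨fun _ => by positivity, hsum, hsum.tsum_le_of_sum_le hle⟩

/-- A rational lies below the value exactly when some program for `x`, found at some stage, is short
enough to witness it. -/
theorem IsOptimalPrefixMachine.lowerSemicomputable (hV : IsOptimalPrefixMachine ∅ V) :
    LowerSemicomputable fun x => (2⁻¹ : ℝ) ^ complexity V x := by
  obtain ⟨r, hr, hVr, -⟩ := (recursiveIn_empty_iff.1 hV.1.1).exists_stage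
  have hdec : Primrec₂ fun (t : List Bool × ℕ × ℕ) (w : List Bool × ℕ) =>
      r (w.1, t.1) w.2 && decide (t.2.1 * 2 ^ w.1.length < t.2.2 + 1) := by
    refine Primrec.and.comp (hr.comp ((Primrec.fst.comp Primrec.snd).pair
      (Primrec.fst.comp Primrec.fst)) (Primrec.snd.comp Primrec.snd)) ?_
    have ht : Primrec fun u : (List Bool × ℕ × ℕ) × List Bool × ℕ => u.1.2 :=
      Primrec.snd.comp Primrec.fst
    exact (Primrec.nat_lt.comp (Primrec.nat_mul.comp (Primrec.fst.comp ht)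
      (primrec_nat_pow.comp (Primrec.const 2)
        (Primrec.list_length.comp (Primrec.fst.comp Primrec.snd))))
      (Primrec.succ.comp (Primrec.snd.comp ht))).decide
  have hsearch : Primrec₂ fun (t : List Bool × ℕ × ℕ) (n : ℕ) =>
      ((Encodable.decode n : Option (List Bool × ℕ)).map fun w =>
        r (w.1, t.1) w.2 && decide (t.2.1 * 2 ^ w.1.length < t.2.2 + 1)).getD false :=
    Primrec.option_getD.comp (Primrec.option_map (Primrec.decode.comp Primrec.snd)
      (hdec.comp (Primrec.fst.comp Primrec.fst) Primrec.snd).to₂) (Primrec.const false)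
  refine (REPred.exists_nat hsearch.to_comp).of_eq fun t => ?_
  obtain ⟨x, a, b⟩ := t
  have hcmp : ∀ k : ℕ, a * 2 ^ k < b + 1 ↔ (a : ℝ) / ((b : ℝ) + 1) < 2⁻¹ ^ k := by
    intro k
    rw [inv_pow, div_lt_iff₀ (by positivity), inv_mul_eq_div, lt_div_iff₀ (by positivity)]
    norm_cast
  simp only [← hcmp]
  constructor
  · rintro ⟨n, hn⟩
    rcases hd : (Encodable.decode n : Option (List Bool × ℕ)) with _ | ⟨p, s⟩
    · simp [hd] at hn
    · simp only [hd, Option.map_some, Option.getD_some, Bool.and_eq_true, decide_eq_true_eq] at hn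
      have := complexity_le ((hVr p x).2 ⟨s, hn.1⟩)
      refine lt_of_le_of_lt ?_ hn.2
      gcongr
      norm_num
  · intro h
    obtain ⟨p, hp, hlen⟩ := exists_program_length_eq_complexity (hV.exists_program x)
    obtain ⟨s, hs⟩ := (hVr p x).1 hp
    exact ⟨Encodable.encode (p, s), by
      simp [-Encodable.encode_prod_val, hs, hlen, Nat.lt_succ_iff.1 h]⟩

end Complexity

/-! ### Coding with a sumtest and the final bound -/

section Main

open Filter

theorem IsUniversalSemimeasure.exists_le_of_machine {m : List Bool → ℝ}
    (hm : IsUniversalSemimeasure m) {V : List Bool →. List Bool}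
    (hV : IsOptimalPrefixMachine ∅ V) :
    ∃ c : ℝ, 0 < c ∧ ∀ x, (2⁻¹ : ℝ) ^ complexity V x ≤ c * m x := by
  obtain ⟨c, hc⟩ := hm.2.2 _ hV.isSemimeasure hV.lowerSemicomputable
  exact ⟨c, pos_of_mul_pos_left (lt_of_lt_of_le (by positivity) (hc [])) (hm.1.1 []), hc⟩

/-- An upper semicomputable sumtest multiplied by its lower semicomputable semimeasure is, up to a
factor, bounded by the algorithmic probability relative to the halting problem. -/
theorem exists_mul_sumtest_le {m e : List Bool → ℝ} (hm : IsSemimeasure m)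
    (hm' : LowerSemicomputable m) (hpos : ∀ x, 0 < m x) (he : IsSumtest m e)
    (he' : UpperSemicomputable e) {VH : List Bool →. List Bool}
    (hVH : IsOptimalPrefixMachine {haltingProblem} VH) :
    ∃ c : ℕ, ∀ x, m x * e x ≤ 2 ^ c * (2⁻¹ : ℝ) ^ complexity VH x := by
  have hpow2 : Computable fun z : List Bool × ℕ => 2 ^ z.2 :=
    primrec_nat_pow.to_comp.comp (Computable.const 2) Computable.snd
  have hlow : REPred fun z : List Bool × ℕ => (2⁻¹ : ℝ) ^ z.2 < m z.1 := by
    refine (hm'.comp (f := fun z : List Bool × ℕ => (z.1, 1, 2 ^ z.2 - 1))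
      (Computable.fst.pair ((Computable.const 1).pair (Computable.pred.comp hpow2)))).of_eq
      fun z => ?_
    have : (((2 ^ z.2 - 1 : ℕ) : ℝ)) + 1 = 2 ^ z.2 := by
      rw [Nat.cast_sub Nat.one_le_two_pow]
      push_cast
      ring
    simp only [this, Nat.cast_one, one_div, inv_pow]
  have hup : REPred fun z : List Bool × ℕ => e z.1 < 2 ^ z.2 := by
    refine (he'.comp (f := fun z : List Bool × ℕ => (z.1, 2 ^ z.2, 0))
      (Computable.fst.pair (hpow2.pair (Computable.const 0)))).of_eq fun z => ?_
    simp
  obtain ⟨A, hA, hAlim⟩ := hlow.exists_limit_find fun x =>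
    exists_pow_lt_of_lt_one (hpos x) (by norm_num)
  obtain ⟨B, hB, hBlim⟩ := hup.exists_limit_find fun x =>
    pow_unbounded_of_one_lt (e x) (by norm_num)
  choose a ha hamin halim using hAlim
  choose b hb hbmin hblim using hBlim
  simp only at ha hamin halim hb hbmin hblim
  have hm1 : ∀ x, m x ≤ 1 := fun x => (hm.2.1.le_tsum x fun y _ => hm.1 y).trans hm.2.2
  have hme0 : ∀ x, 0 ≤ m x * e x := fun x => mul_nonneg (hm.1 x) (he.1 x)
  have hme1 : ∀ x, m x * e x ≤ 1 := fun x => (he.2.1.le_tsum x fun y _ => hme0 y).trans he.2.2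
  have hm2 : ∀ x, m x ≤ 2 * 2⁻¹ ^ a x := by
    intro x
    rcases h : a x with _ | k
    · simpa using (hm1 x).trans one_le_two
    · have := not_lt.1 (hamin x k (by omega))
      rw [pow_succ]
      linarith
  -- The summand 1 covers `b x = 0`, where minimality says nothing about `e x`.
  have he2 : ∀ x, (2 : ℝ) ^ b x ≤ 1 + 2 * e x := by
    intro x
    rcases h : b x with _ | k
    · simpa using he.1 x
    · have := not_lt.1 (hbmin x k (by omega))
      rw [pow_succ]
      linarith
  have hprod : ∀ x, (2⁻¹ : ℝ) ^ a x * 2 ^ b x ≤ m x + 2 * (m x * e x) := by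
    intro x
    calc (2⁻¹ : ℝ) ^ a x * 2 ^ b x ≤ m x * (1 + 2 * e x) :=
          mul_le_mul (ha x).le (he2 x) (by positivity) (hm.1 x)
      _ = _ := by ring
  -- This makes the truncated subtraction in the length `a x + 2 - b x` exact. The 2 also supplies
  -- the factor 1/4 that brings the total weight, at most 1 + 2, below 1.
  have hba : ∀ x, b x ≤ a x + 2 := by
    intro x
    have h : (2⁻¹ : ℝ) ^ a x * 2 ^ b x ≤ 2 ^ 2 := by linarith [hprod x, hm1 x, hme1 x]
    rw [inv_pow, inv_mul_eq_div, div_le_iff₀ (by positivity), ← pow_add] at h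
    have := (pow_le_pow_iff_right₀ (by norm_num : (1 : ℝ) < 2)).1 h
    omega
  have hlen : ∀ x, (2⁻¹ : ℝ) ^ (a x + 2 - b x) = 2⁻¹ ^ a x * 2 ^ b x / 4 := by
    intro x
    have h : (2⁻¹ : ℝ) ^ (a x + 2 - b x) * 2⁻¹ ^ b x = 2⁻¹ ^ (a x + 2) := by
      rw [← pow_add, Nat.sub_add_cancel (hba x)]
    rw [pow_add, inv_pow 2 (b x), ← div_eq_mul_inv, div_eq_iff (by positivity)] at h
    rw [h]
    ring
  obtain ⟨E, hE⟩ := exists_computable_equiv_string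
  have hν : Computable fun z : ℕ × ℕ => A (E z.1, z.2) + 2 - B (E z.1, z.2) := by
    have hz : Computable fun z : ℕ × ℕ => (E z.1, z.2) :=
      (hE.comp Computable.fst).pair Computable.snd
    exact Primrec.nat_sub.to_comp.comp
      (Primrec.nat_add.to_comp.comp (hA.comp hz) (Computable.const 2)) (hB.comp hz)
  obtain ⟨W, hW, hprog⟩ := exists_prefixMachine_haltingProblem hE hν
    (n := fun i => a (E i) + 2 - b (E i))
    (fun i => by
      filter_upwards [halim (E i), hblim (E i)] with s h1 h2
      simp only [h1, h2])
    (fun k => by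
      have hs : ∑ i ∈ Finset.range k, (m (E i) + 2 * (m (E i) * e (E i))) ≤ 3 := by
        rw [Finset.sum_add_distrib, ← Finset.mul_sum]
        have h1 : ∑ i ∈ Finset.range k, m (E i) ≤ 1 :=
          ((E.summable_iff.2 hm.2.1).sum_le_tsum _ fun i _ => hm.1 (E i)).trans
            ((E.tsum_eq m).trans_le hm.2.2)
        have h2 : ∑ i ∈ Finset.range k, m (E i) * e (E i) ≤ 1 :=
          ((E.summable_iff.2 he.2.1).sum_le_tsum _ fun i _ => hme0 (E i)).trans
            ((E.tsum_eq fun x => m x * e x).trans_le he.2.2)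
        linarith
      calc ∑ i ∈ Finset.range k, (2⁻¹ : ℝ) ^ (a (E i) + 2 - b (E i))
          ≤ ∑ i ∈ Finset.range k, (m (E i) + 2 * (m (E i) * e (E i))) / 4 :=
            Finset.sum_le_sum fun i _ => by
              rw [hlen]
              linarith [hprod (E i)]
        _ ≤ 1 := by
            rw [← Finset.sum_div]
            linarith)
  obtain ⟨c, hc⟩ := hVH.2 W hW
  -- The 4 collects one bit from `hm2`, two from the shift in the length, and one from the
  -- Shannon–Fano code.
  refine ⟨c + 4, fun x => ?_⟩
  obtain ⟨p, hp, hplen⟩ := hprog (E.symm x)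
  obtain ⟨q, hq, hqlen⟩ := hc p _ hp
  rw [E.apply_symm_apply] at hq hplen
  have hK : complexity VH x ≤ a x + 2 - b x + (1 + c) := by
    have := complexity_le hq
    omega
  have h1 : (2⁻¹ : ℝ) ^ (a x + 2 - b x + (1 + c)) ≤ 2⁻¹ ^ complexity VH x :=
    pow_le_pow_of_le_one (by norm_num) (by norm_num) hK
  rw [pow_add, hlen] at h1
  have h2 : (2 : ℝ) ^ (c + 4) * (2⁻¹ ^ a x * 2 ^ b x / 4 * 2⁻¹ ^ (1 + c)) =
      2 * 2⁻¹ ^ a x * 2 ^ b x := by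
    rw [inv_pow 2 (1 + c), pow_add, pow_add]
    field_simp
    norm_num
  calc m x * e x ≤ 2 * 2⁻¹ ^ a x * 2 ^ b x :=
        mul_le_mul (hm2 x) (hb x).le (he.1 x) (by positivity)
    _ ≤ _ := by
        rw [← h2]
        gcongr

theorem corollary2
    -- the machines that define `K` and its version with an oracle for the halting problem
    (V VH : List Bool →. List Bool)
    (hV : IsOptimalPrefixMachine ∅ V)
    (hVH : IsOptimalPrefixMachine {haltingProblem} VH)
    (m : List Bool → ℝ) (hm : IsUniversalSemimeasure m)
    (e : List Bool → ℝ) (he : IsSumtest m e) (he' : UpperSemicomputable e) :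
    -- `log 0` is minus infinity, so strings with `e x = 0` satisfy the bound by convention
    ∃ C : ℝ, ∀ x : List Bool, 0 < e x →
      Real.logb 2 (e x) ≤ (complexity V x : ℝ) - (complexity VH x : ℝ) + C := by
  obtain ⟨c, hc0, hc⟩ := hm.exists_le_of_machine hV
  have hpos : ∀ x, 0 < m x := fun x =>
    pos_of_mul_pos_right (lt_of_lt_of_le (by positivity) (hc x)) hc0.le
  obtain ⟨d, hd⟩ := exists_mul_sumtest_le hm.1 hm.2.1 hpos he he' hVH
  refine ⟨Real.logb 2 (c * 2 ^ d), fun x hx => ?_⟩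
  have h1 : e x * 2⁻¹ ^ complexity V x ≤ c * 2 ^ d * 2⁻¹ ^ complexity VH x :=
    calc e x * 2⁻¹ ^ complexity V x ≤ e x * (c * m x) := by gcongr; exact hc x
      _ = c * (m x * e x) := by ring
      _ ≤ c * (2 ^ d * 2⁻¹ ^ complexity VH x) := mul_le_mul_of_nonneg_left (hd x) hc0.le
      _ = _ := by ring
  have h2 := Real.logb_le_logb_of_le (b := 2) (by norm_num) (by positivity) h1
  rw [Real.logb_mul hx.ne' (by positivity), Real.logb_mul (by positivity) (by positivity),
    Real.logb_pow, Real.logb_pow, Real.logb_inv, Real.logb_self_eq_one (by norm_num)] at h2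
  linarith

end Main
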